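/- Let $g(r)=\max\{0,-r\}$ be the ReLU loss. For a probability measure $\mathcal P$ on $\mathbb R^d$ and $k\in\mathbb N$, $k\ge 1$, put $f_0(x)=\int g(\langle a,x\rangle)\,d\mathcal P(a)$ and $f(x)=f_0(x)+\|x\|_2^2/k$. Given a measurable score $s\colon\mathbb R^d\to[0,\infty)$ with $0<S=\int s\,d\mathcal P<\infty$, draw $m$ i.i.d. samples $a_1,\dots,a_m$ from $d\mathcal Q=\frac{s}{S}\,d\mathcal P$ and give them the weights $w_i=S/s(a_i)$ (the choice $s\equiv1$ is plain sampling from $\mathcal P$ with unit weights). For $\varepsilon\in(0,1)$, the relative error guarantee is $$\forall x\in\mathbb R^d:\quad \Big|f_0(x)-\frac1m\sum_{i=1}^m w_i\,g(\langle a_i,x\rangle)\Big|\le\varepsilon f(x).\qquad(*)$$ **Theorem.** There are absolute constants $c,C>0$ such that the following holds. 1. For all $n\ge d\ge 2$ and $\varepsilon\in(0,1)$ there are $n$ distinct points in $\mathbb R^d$ such that, for $\mathcal P$ the uniform distribution on these points, for every $k\ge1$, every score $s$ as above and every $m\le c\,\varepsilon^{-2}\,n\log n$, the guarantee $(*)$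 fails with probability at least $1-C/n$. That is, with high probability $\Omega(\varepsilon^{-2}n\log n)$ samples, hence in particular $\Omega(n\log n)$ samples, are required. 2. If $d\ge3$, the conclusion of 1 holds for the uniform distribution on any $n\ge d$ distinct points of the moment curve $t\mapsto(1,t,t^2,\dots,t^{d-1})$ in $\mathbb R^d$; in particular the points can be chosen independently of $\varepsilon$. Consequently no sample size that is independent of the dimension or sublinear in the support size $n$ can suffice. -/

import Mathlib

open MeasureTheory ProbabilityTheory

/-- The ReLU loss `g(r) = max {0, -r}`. -/
noncomputable def reluLoss (r : ℝ) : ℝ := max 0 (-r)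

/-- The expected loss `f₀(x) = ∫ g(⟨a, x⟩) dP(a)`. -/
noncomputable def expectedLoss {d : ℕ} (P : Measure (EuclideanSpace ℝ (Fin d)))
    (x : EuclideanSpace ℝ (Fin d)) : ℝ :=
  ∫ a, reluLoss (inner ℝ a x) ∂P

/-- The regularized loss `f(x) = f₀(x) + ‖x‖₂² / k`. -/
noncomputable def regularizedLoss {d : ℕ} (P : Measure (EuclideanSpace ℝ (Fin d))) (k : ℕ)
    (x : EuclideanSpace ℝ (Fin d)) : ℝ :=
  expectedLoss P x + ‖x‖ ^ 2 / (k : ℝ)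

/-- The total score `S = ∫ s(a) dP(a)`. -/
noncomputable def totalScore {d : ℕ} (P : Measure (EuclideanSpace ℝ (Fin d)))
    (s : EuclideanSpace ℝ (Fin d) → ℝ) : ℝ :=
  ∫ a, s a ∂P

/-- The importance sampling distribution `dQ(a) = (s(a) / S) dP(a)`. -/
noncomputable def samplingDist {d : ℕ} (P : Measure (EuclideanSpace ℝ (Fin d)))
    (s : EuclideanSpace ℝ (Fin d) → ℝ) : Measure (EuclideanSpace ℝ (Fin d)) :=
  P.withDensity (fun a => ENNReal.ofReal (s a / totalScore P s))

/-- The importance weight `w(a) = S / s(a)`. -/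
noncomputable def sampleWeight {d : ℕ} (P : Measure (EuclideanSpace ℝ (Fin d)))
    (s : EuclideanSpace ℝ (Fin d) → ℝ) (a : EuclideanSpace ℝ (Fin d)) : ℝ :=
  totalScore P s / s a

/-- The law of `m` independent samples from the importance sampling distribution. -/
noncomputable def sampleLaw {d : ℕ} (P : Measure (EuclideanSpace ℝ (Fin d)))
    (s : EuclideanSpace ℝ (Fin d) → ℝ) (m : ℕ) :
    Measure (Fin m → EuclideanSpace ℝ (Fin d)) :=
  Measure.pi (fun _ => samplingDist P s)

/-- The weighted empirical loss `(1/m) ∑ᵢ w(aᵢ) g(⟨aᵢ, x⟩)` of a sample `A = (a₁, …, aₘ)`. -/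
noncomputable def empiricalLoss {d : ℕ} (P : Measure (EuclideanSpace ℝ (Fin d)))
    (s : EuclideanSpace ℝ (Fin d) → ℝ) {m : ℕ} (A : Fin m → EuclideanSpace ℝ (Fin d))
    (x : EuclideanSpace ℝ (Fin d)) : ℝ :=
  (1 / (m : ℝ)) * ∑ i, sampleWeight P s (A i) * reluLoss (inner ℝ (A i) x)

/-- The relative error guarantee, uniformly over all query vectors `x`. -/
def RelErrorGuarantee {d : ℕ} (P : Measure (EuclideanSpace ℝ (Fin d)))
    (s : EuclideanSpace ℝ (Fin d) → ℝ) (k : ℕ) (ε : ℝ) {m : ℕ}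
    (A : Fin m → EuclideanSpace ℝ (Fin d)) : Prop :=
  ∀ x : EuclideanSpace ℝ (Fin d),
    |expectedLoss P x - empiricalLoss P s A x| ≤ ε * regularizedLoss P k x

/-- More than `M` samples are required for the relative error guarantee, except with
probability `p`: whatever the regularization parameter `k` and the sampling score `s`
(`s = 1` is plain sampling from `P`), any `m ≤ M` samples violate the guarantee with probability
at least `1 - p`. -/
def RequiresSamples {d : ℕ} (P : Measure (EuclideanSpace ℝ (Fin d))) (ε M p : ℝ) : Prop :=
  ∀ k : ℕ, 1 ≤ k →
  ∀ s : EuclideanSpace ℝ (Fin d) → ℝ, Measurable s → (∀ a, 0 ≤ s a) → 0 < totalScore P s →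
  ∀ m : ℕ, (m : ℝ) ≤ M →
    1 - p ≤ (sampleLaw P s m).real {A | ¬ RelErrorGuarantee P s k ε A}

/-- The moment curve `t ↦ (1, t, t², …, t^(d-1))` in `ℝ^d`. -/
noncomputable def momentCurve (d : ℕ) (t : ℝ) : EuclideanSpace ℝ (Fin d) :=
  WithLp.toLp 2 (fun i : Fin d => t ^ (i : ℕ))

/-! Both losses are homogeneous of degree one and the penalty is of degree two, so scaling `x` to
zero turns the guarantee into a pure relative error bound. On `n` points of equal mass, the weight
of point `j` cancels its sampling probability `p j`, so only the relative errors `D j = 1 -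
occurrences ω j / (m * p j)` of the counts matter. If suitable queries `x` single out each point,
then every `|D j|` is small. This is a coupon collector problem: all `n` bins must receive almost
their expected number of balls.

For the balls, at least half of the bins have `p j ≤ 2 / n`. A reverse Chernoff bound
(`le_binomialExp_lower_tail`) makes each of them fall short with probability of order at least `n ^
(-1/2)`. Negative dependence (`multinomial_prod_le`) bounds the probability that none does by a
product, which is at most `exp (-x)` with `x` of order `√n`, hence `O(1/n)`.

For the points, a quadratic negative at a single parameter isolates a point of the moment curve. In
the plane such isolation is not available for every point, so the lengths grow geometrically and the
last point of an initial segment dominates its loss. -/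

/-! ### Binomial expectations and a lower bound for the lower tail. -/

/-- The expectation of `h` under the binomial distribution with `m` trials and success
probability `p`, computed by conditioning on the first trial. -/
noncomputable def binomialExp (p : ℝ) : ℕ → (ℕ → ℝ) → ℝ
  | 0, h => h 0
  | m + 1, h => p * binomialExp p m (fun k => h (k + 1)) + (1 - p) * binomialExp p m h

lemma binomialExp_mono {p : ℝ} (hp0 : 0 ≤ p) (hp1 : p ≤ 1) (m : ℕ) {h h' : ℕ → ℝ}
    (hle : ∀ k, h k ≤ h' k) : binomialExp p m h ≤ binomialExp p m h' := by
  induction m generalizing h h' with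
  | zero => exact hle 0
  | succ m ih =>
    exact add_le_add (mul_le_mul_of_nonneg_left (ih fun k => hle (k + 1)) hp0)
      (mul_le_mul_of_nonneg_left (ih hle) (sub_nonneg.2 hp1))

lemma binomialExp_const (p : ℝ) (m : ℕ) (c : ℝ) : binomialExp p m (fun _ => c) = c := by
  induction m with
  | zero => rfl
  | succ m ih => simp only [binomialExp, ih]; ring

lemma binomialExp_nonneg {p : ℝ} (hp0 : 0 ≤ p) (hp1 : p ≤ 1) (m : ℕ) {h : ℕ → ℝ}
    (hh : ∀ k, 0 ≤ h k) : 0 ≤ binomialExp p m h := by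
  simpa [binomialExp_const] using binomialExp_mono hp0 hp1 m (h := fun _ => 0) hh

lemma binomialExp_const_sub_mul (p : ℝ) (m : ℕ) (h : ℕ → ℝ) (c b : ℝ) :
    binomialExp p m (fun k => c - b * h k) = c - b * binomialExp p m h := by
  induction m generalizing h with
  | zero => rfl
  | succ m ih =>
    simp only [binomialExp]
    rw [ih h, ih fun k => h (k + 1)]
    ring

/-- The centre is arbitrary because conditioning on a first success shifts it by one. -/
lemma binomialExp_sub_sq (p : ℝ) (m : ℕ) (c : ℝ) :
    binomialExp p m (fun k => ((k : ℝ) - c) ^ 2) = m * p * (1 - p) + (m * p - c) ^ 2 := by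
  induction m generalizing c with
  | zero => simp [binomialExp]
  | succ m ih =>
    have : (fun k : ℕ => (((k + 1 : ℕ) : ℝ) - c) ^ 2) = fun k : ℕ => ((k : ℝ) - (c - 1)) ^ 2 := by
      funext k; push_cast; ring
    simp only [binomialExp]
    rw [this, ih, ih]
    push_cast
    ring

/-- Cauchy–Schwarz comparison of two binomial distributions through their `χ²` divergence. -/
lemma sq_binomialExp_le {p p' : ℝ} (hp0 : 0 < p) (hp1 : p < 1)
    (m : ℕ) (h : ℕ → ℝ) :
    binomialExp p' m h ^ 2 ≤
      (1 + (p - p') ^ 2 / (p * (1 - p))) ^ m * binomialExp p m (fun k => h k ^ 2) := by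
  have hq : 0 < 1 - p := sub_pos.2 hp1
  induction m generalizing h with
  | zero => simp [binomialExp]
  | succ m ih =>
    simp only [binomialExp]
    set χ := 1 + (p - p') ^ 2 / (p * (1 - p)) with hχ
    have hχ0 : 0 ≤ χ := by positivity
    have h1 := ih h
    have h2 := ih fun k => h (k + 1)
    set a := binomialExp p' m fun k => h (k + 1)
    set b := binomialExp p' m h
    set A := binomialExp p m fun k => h (k + 1) ^ 2
    set B := binomialExp p m fun k => h k ^ 2
    -- Cauchy–Schwarz for one trial, since `χ = p' ^ 2 / p + (1 - p') ^ 2 / (1 - p)`.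
    have key : (p' * a + (1 - p') * b) ^ 2 ≤ χ * (p * a ^ 2 + (1 - p) * b ^ 2) := by
      have : χ * (p * a ^ 2 + (1 - p) * b ^ 2) - (p' * a + (1 - p') * b) ^ 2
          = (p' * (1 - p) * b - (1 - p') * p * a) ^ 2 / (p * (1 - p)) := by
        rw [hχ]; field_simp; ring
      have h0 : 0 ≤ (p' * (1 - p) * b - (1 - p') * p * a) ^ 2 / (p * (1 - p)) := by positivity
      linarith
    calc (p' * a + (1 - p') * b) ^ 2 ≤ χ * (p * a ^ 2 + (1 - p) * b ^ 2) := key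
      _ ≤ χ * (p * (χ ^ m * A) + (1 - p) * (χ ^ m * B)) := by gcongr
      _ = χ ^ (m + 1) * (p * A + (1 - p) * B) := by ring

/-- A lower bound for the lower tail of a binomial distribution (a reverse Chernoff bound). -/
lemma le_binomialExp_lower_tail {p ε : ℝ} {m : ℕ} (hp0 : 0 < p) (hp1 : p ≤ 1 / 2) (hε0 : 0 < ε)
    (hε1 : ε < 1) (hm : 0 < m) :
    Real.exp (-(2 * (4 * ε ^ 2 * (m * p) + 8))) / 4 ≤
      binomialExp p m (fun k => if (k : ℝ) < (1 - ε) * (m * p) then 1 else 0) := by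
  set u : ℝ := m * p with hu
  have hu0 : 0 < u := by positivity
  set h : ℕ → ℝ := fun k => if (k : ℝ) < (1 - ε) * u then 1 else 0 with hh
  have hhsq : (fun k => h k ^ 2) = h := by funext k; simp only [hh]; split_ifs <;> norm_num
  -- Change of measure: under success probability `(1 - δ) * p` the event has probability at least
  -- `1 / 2`, and the `χ²` comparison carries this back to `p` at cost `exp (2 * δ ^ 2 * u)`.
  obtain ⟨δ, hδ0, hδ1, hδu, hhalf⟩ : ∃ δ : ℝ, 0 ≤ δ ∧ δ ≤ 1 ∧ δ ^ 2 * u ≤ 4 * ε ^ 2 * u + 8 ∧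
      1 / 2 ≤ binomialExp ((1 - δ) * p) m h := by
    set δ₀ := max (2 * ε) (√(8 / u)) with hδ₀
    have hδ₀pos : 0 < δ₀ := lt_max_of_lt_left (by positivity)
    have hsq : δ₀ ^ 2 * u ≤ 4 * ε ^ 2 * u + 8 := by
      rcases max_choice (2 * ε) (√(8 / u)) with h1 | h1
      · rw [hδ₀, h1]; nlinarith
      · rw [hδ₀, h1, Real.sq_sqrt (by positivity)]
        have : 8 / u * u = 8 := by field_simp
        rw [this]; nlinarith [sq_nonneg ε]
    rcases le_or_gt 1 δ₀ with h1 | h1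
    -- With `δ = 1` the changed law sits at `0`, which lies in the event.
    · refine ⟨1, zero_le_one, le_rfl, ?_, ?_⟩
      · have : (1 : ℝ) ^ 2 ≤ δ₀ ^ 2 := by gcongr
        exact (mul_le_mul_of_nonneg_right this hu0.le).trans hsq
      · have hz : ∀ m : ℕ, binomialExp ((1 - 1) * p) m h = h 0 := by
          intro m
          induction m with
          | zero => rfl
          | succ m ih => simp only [binomialExp, ih]; ring
        have : h 0 = 1 := by
          simp only [hh]; rw [if_pos]; push_cast; exact mul_pos (by linarith) hu0
        rw [hz, this]; norm_num
    · refine ⟨δ₀, hδ₀pos.le, h1.le, hsq, ?_⟩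
      have h2 : 2 * ε ≤ δ₀ := le_max_left _ _
      have h8 : 8 ≤ δ₀ ^ 2 * u := by
        have : √(8 / u) ≤ δ₀ := le_max_right _ _
        have h3 : 8 / u ≤ δ₀ ^ 2 := by
          rw [← Real.sq_sqrt (show 0 ≤ 8 / u by positivity)]
          gcongr
        rwa [div_le_iff₀ hu0] at h3
      have hp'0 : 0 ≤ (1 - δ₀) * p := mul_nonneg (by linarith) hp0.le
      have hp'1 : (1 - δ₀) * p ≤ 1 := by nlinarith
      -- Chebyshev: as `2 * ε ≤ δ₀`, the new mean is at least `r` below the threshold, and `8 ≤ δ₀ ^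
      -- 2 * u` makes the variance at most `r ^ 2 / 2`.
      set r := (δ₀ * u / 2) with hr
      have hr0 : 0 < r := by positivity
      have hle : ∀ k : ℕ, 1 - 1 / r ^ 2 * ((k : ℝ) - (1 - δ₀) * u) ^ 2 ≤ h k := by
        intro k
        simp only [hh]
        split_ifs with hk
        · have : 0 ≤ 1 / r ^ 2 * ((k : ℝ) - (1 - δ₀) * u) ^ 2 := by positivity
          linarith
        · have hk' : r ≤ (k : ℝ) - (1 - δ₀) * u := by
            rw [not_lt] at hk; rw [hr]; nlinarith
          have : r ^ 2 ≤ ((k : ℝ) - (1 - δ₀) * u) ^ 2 := by gcongr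
          rw [sub_nonpos, one_div_mul_eq_div, le_div_iff₀ (by positivity)]
          linarith
      refine le_trans ?_ (binomialExp_mono hp'0 hp'1 m hle)
      rw [binomialExp_const_sub_mul, binomialExp_sub_sq]
      have e1 : (m : ℝ) * ((1 - δ₀) * p) = (1 - δ₀) * u := by rw [hu]; ring
      rw [e1, sub_self]
      have hv : (1 - δ₀) * u * (1 - (1 - δ₀) * p) ≤ u := by
        have : (1 - δ₀) * u ≤ u := by nlinarith
        have h5 : 0 ≤ (1 - δ₀) * u := mul_nonneg (by linarith) hu0.le
        nlinarith
      have hr2 : 2 * u ≤ r ^ 2 := by rw [hr]; nlinarith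
      have : 1 / r ^ 2 * ((1 - δ₀) * u * (1 - (1 - δ₀) * p) + 0 ^ 2) ≤ 1 / 2 := by
        rw [one_div_mul_eq_div, div_le_iff₀ (by positivity)]
        linarith
      linarith
  have hp'0 : 0 ≤ (1 - δ) * p := mul_nonneg (by linarith) hp0.le
  have hp'1 : (1 - δ) * p ≤ 1 := by nlinarith
  have hcs := sq_binomialExp_le hp0 (by linarith : p < 1) (p' := (1 - δ) * p) m h
  rw [hhsq] at hcs
  have hB0 : 0 ≤ binomialExp p m h := by
    refine binomialExp_nonneg hp0.le (by linarith) m fun k => ?_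
    simp only [hh]; split_ifs <;> norm_num
  have hχ : (1 + (p - (1 - δ) * p) ^ 2 / (p * (1 - p))) ^ m
      ≤ Real.exp (2 * (4 * ε ^ 2 * u + 8)) := by
    have h1 : 1 + (p - (1 - δ) * p) ^ 2 / (p * (1 - p)) ≤ Real.exp (2 * δ ^ 2 * p) := by
      refine le_trans ?_ (Real.add_one_le_exp _)
      rw [add_comm]
      gcongr
      rw [div_le_iff₀ (mul_pos hp0 (by linarith))]
      have : 0 ≤ δ ^ 2 * p ^ 2 := by positivity
      nlinarith
    calc _ ≤ Real.exp (2 * δ ^ 2 * p) ^ m := by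
          have : 0 < 1 - p := by linarith
          gcongr
      _ = Real.exp (2 * (δ ^ 2 * u)) := by rw [← Real.exp_nat_mul, hu]; ring_nf
      _ ≤ _ := by gcongr
  have h4 : (1 / 2 : ℝ) ^ 2 ≤ binomialExp ((1 - δ) * p) m h ^ 2 := by gcongr
  rw [Real.exp_neg, div_le_iff₀ (by norm_num), inv_le_iff_one_le_mul₀ (Real.exp_pos _)]
  nlinarith [mul_le_mul_of_nonneg_right hχ hB0]

/-! ### Multinomial counts and balls in bins. -/

/-- The number of times the value `j` is taken by `ω`. -/
def occurrences {ι : Type*} [DecidableEq ι] {m : ℕ} (ω : Fin m → ι) (j : ι) : ℕ :=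
  ∑ i, if ω i = j then 1 else 0

/-- A single draw `k` hits at most one `j`, so expanding the left side leaves only terms with at
most one factor `y j`; the right side has further nonnegative terms. -/
lemma sum_mul_prod_add_ite_le {ι : Type*} [Fintype ι] [DecidableEq ι] {p x y : ι → ℝ}
    (hp : ∀ j, 0 ≤ p j) (hp1 : ∑ j, p j = 1) (hx : ∀ j, 0 ≤ x j) (hy : ∀ j, 0 ≤ y j)
    (s : Finset ι) :
    ∑ k, p k * ∏ j ∈ s, (x j + if k = j then y j else 0) ≤ ∏ j ∈ s, (x j + p j * y j) := by
  induction s using Finset.induction_on with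
  | empty => simp [hp1]
  | insert a s ha ih =>
    have hle : ∏ j ∈ s, x j ≤ ∏ j ∈ s, (x j + p j * y j) :=
      Finset.prod_le_prod (fun j _ => hx j) fun j _ =>
        le_add_of_nonneg_right (mul_nonneg (hp j) (hy j))
    have hsplit : ∀ k, p k * ∏ j ∈ insert a s, (x j + if k = j then y j else 0)
        = x a * (p k * ∏ j ∈ s, (x j + if k = j then y j else 0))
          + if k = a then p a * y a * ∏ j ∈ s, x j else 0 := by
      intro k
      rw [Finset.prod_insert ha]
      split_ifs with hk
      · subst hk
        have : ∏ j ∈ s, (x j + if k = j then y j else 0) = ∏ j ∈ s, x j :=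
          Finset.prod_congr rfl fun j hj => by
            rw [if_neg (by rintro rfl; exact ha hj), add_zero]
        rw [this]; ring
      · ring
    rw [Finset.sum_congr rfl fun k _ => hsplit k, Finset.sum_add_distrib, ← Finset.mul_sum,
      Finset.sum_ite_eq' Finset.univ a, if_pos (Finset.mem_univ a), Finset.prod_insert ha, add_mul]
    exact add_le_add (mul_le_mul_of_nonneg_left ih (hx a))
      (mul_le_mul_of_nonneg_left hle (mul_nonneg (hp a) (hy a)))

lemma sum_fin_succ_fun {ι : Type*} [Fintype ι] {m : ℕ} (F : (Fin (m + 1) → ι) → ℝ) :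
    ∑ ω, F ω = ∑ k, ∑ ω : Fin m → ι, F (Fin.cons k ω) := by
  rw [← (Fin.consEquiv fun _ : Fin (m + 1) => ι).sum_comp F, Fintype.sum_prod_type]
  rfl

/-- Negative dependence of multinomial counts: the expectation of a product of increasing
functions of the counts is at most the product of the expectations. -/
lemma multinomial_prod_le {ι : Type*} [Fintype ι] [DecidableEq ι] {p : ι → ℝ}
    (hp : ∀ j, 0 ≤ p j) (hp1 : ∑ j, p j = 1) (m : ℕ) {h : ι → ℕ → ℝ}
    (hh : ∀ j, Monotone (h j)) (hh0 : ∀ j k, 0 ≤ h j k) :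
    ∑ ω : Fin m → ι, (∏ i, p (ω i)) * ∏ j, h j (occurrences ω j)
      ≤ ∏ j, binomialExp (p j) m (h j) := by
  have hple : ∀ j, p j ≤ 1 := fun j =>
    hp1 ▸ Finset.single_le_sum (fun i _ => hp i) (Finset.mem_univ j)
  induction m generalizing h with
  | zero => simp [binomialExp, occurrences]
  | succ m ih =>
    -- Condition on the first ball: `x j` is the expectation if it misses bin `j`, and `y j` is the
    -- gain if it hits.
    set x : ι → ℝ := fun j => binomialExp (p j) m (h j) with hx
    set y : ι → ℝ := fun j => binomialExp (p j) m (fun k => h j (k + 1)) - x j with hy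
    have hx0 : ∀ j, 0 ≤ x j := fun j => binomialExp_nonneg (hp j) (hple j) m (hh0 j)
    have hy0 : ∀ j, 0 ≤ y j := fun j =>
      sub_nonneg.2 (binomialExp_mono (hp j) (hple j) m fun k => hh j (Nat.le_succ k))
    have hstep : ∀ k : ι, ∑ ω : Fin m → ι, (∏ i, p ((Fin.cons k ω : Fin (m + 1) → ι) i)) *
          ∏ j, h j (occurrences (Fin.cons k ω : Fin (m + 1) → ι) j)
        ≤ p k * ∏ j, (x j + if k = j then y j else 0) := by
      intro k
      have h1 := ih (h := fun j r => h j (r + if k = j then 1 else 0))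
        (fun j a b hab => hh j (by omega)) (fun j r => hh0 j _)
      have h2 : ∀ j, binomialExp (p j) m (fun r => h j (r + if k = j then 1 else 0))
          = x j + if k = j then y j else 0 := by
        intro j
        split_ifs
        · simp [hy]
        · simp [hx]
      simp only [h2] at h1
      refine le_trans (le_of_eq ?_) (mul_le_mul_of_nonneg_left h1 (hp k))
      rw [Finset.mul_sum]
      refine Finset.sum_congr rfl fun ω _ => ?_
      simp only [occurrences, Fin.prod_univ_succ, Fin.sum_univ_succ, Fin.cons_zero, Fin.cons_succ]
      rw [mul_assoc]
      simp only [add_comm]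
    rw [sum_fin_succ_fun]
    refine (Finset.sum_le_sum fun k _ => hstep k).trans ?_
    refine (sum_mul_prod_add_ite_le hp hp1 hx0 hy0 Finset.univ).trans (le_of_eq ?_)
    refine Finset.prod_congr rfl fun j _ => ?_
    simp only [binomialExp, hx, hy]
    ring

/-- Markov's inequality: at most `n / 2` of the probabilities exceed `2 / n`. -/
lemma card_le_two_mul_card_filter_le {n : ℕ} (hn : 0 < n) {p : Fin n → ℝ} (hp : ∀ j, 0 ≤ p j)
    (hp1 : ∑ j, p j = 1) :
    (n : ℝ) / 2 ≤ (Finset.univ.filter fun j => p j ≤ 2 / n).card := by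
  have hn0 : (0 : ℝ) < n := by exact_mod_cast hn
  have hcard := Finset.card_filter_add_card_filter_not (s := (Finset.univ : Finset (Fin n)))
    (fun j => p j ≤ 2 / n)
  rw [Finset.card_univ, Fintype.card_fin] at hcard
  have h1 : ((Finset.univ.filter fun j => ¬ p j ≤ 2 / n).card : ℝ) * (2 / n) ≤ 1 := by
    rw [← nsmul_eq_mul, ← hp1]
    refine (Finset.card_nsmul_le_sum _ p _ fun j hj => ?_).trans
      (Finset.sum_le_univ_sum_of_nonneg hp)
    exact (not_le.1 (Finset.mem_filter.1 hj).2).le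
  rw [← mul_div_assoc, div_le_one hn0] at h1
  have : ((Finset.univ.filter fun j => p j ≤ 2 / n).card : ℝ)
      + (Finset.univ.filter fun j => ¬ p j ≤ 2 / n).card = n := by exact_mod_cast hcard
  linarith

/-- If fewer than about `ε⁻² n log n` balls are thrown into `n` bins, then with high probability
some bin receives less than `1 - ε` times the expected number of balls. -/
theorem multinomial_all_large_le {n : ℕ} (hn : 0 < n) {p : Fin n → ℝ} (hp : ∀ j, 0 ≤ p j)
    (hp1 : ∑ j, p j = 1) {ε : ℝ} (hε0 : 0 < ε) (hε1 : ε < 1) {m : ℕ}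
    (hm : (m : ℝ) ≤ 1 / 32 * (ε ^ 2)⁻¹ * n * Real.log n) (G : Finset (Fin m → Fin n))
    (hG : ∀ ω ∈ G, ∀ j, 0 < m * p j ∧ (1 - ε) * (m * p j) ≤ occurrences ω j) :
    ∑ ω ∈ G, ∏ i, p (ω i) ≤ 128 * Real.exp 32 / n := by
  have hn0 : (0 : ℝ) < n := by exact_mod_cast hn
  have hple : ∀ j, p j ≤ 1 := fun j =>
    hp1 ▸ Finset.single_le_sum (fun i _ => hp i) (Finset.mem_univ j)
  have hprod : ∀ ω : Fin m → Fin n, 0 ≤ ∏ i, p (ω i) := fun ω =>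
    Finset.prod_nonneg fun i _ => hp _
  rcases lt_or_ge n 4 with hn4 | hn4
  · have h1 : ∑ ω ∈ G, ∏ i, p (ω i) ≤ 1 := by
      calc _ ≤ ∑ ω : Fin m → Fin n, ∏ i, p (ω i) := Finset.sum_le_univ_sum_of_nonneg hprod
        _ = 1 := by rw [← Fintype.sum_pow, hp1, one_pow]
    refine h1.trans ((one_le_div hn0).2 ?_)
    have h2 : (n : ℝ) ≤ 4 := by exact_mod_cast hn4.le
    have h3 : (1 : ℝ) ≤ Real.exp 32 := Real.one_le_exp (by norm_num)
    linarith
  rcases G.eq_empty_or_nonempty with rfl | ⟨ω₀, hω₀⟩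
  · rw [Finset.sum_empty]; positivity
  have hmp : ∀ j, 0 < m * p j := fun j => (hG ω₀ hω₀ j).1
  have hp0 : ∀ j, 0 < p j := fun j => pos_of_mul_pos_right (hmp j) (Nat.cast_nonneg m)
  have hm0 : 0 < m := by
    rcases Nat.eq_zero_or_pos m with h | h
    · have := hmp ⟨0, hn⟩; simp [h] at this
    · exact h
  set h : Fin n → ℕ → ℝ := fun j k => if (1 - ε) * (m * p j) ≤ k then 1 else 0 with hh
  have hmono : ∀ j, Monotone (h j) := by
    intro j a b hab
    have hab' : (a : ℝ) ≤ b := by exact_mod_cast hab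
    simp only [hh]
    split_ifs with h1 h2
    · exact le_rfl
    · exact absurd (h1.trans hab') h2
    · exact zero_le_one
    · exact le_rfl
  have hnn : ∀ j k, 0 ≤ h j k := by
    intro j k; simp only [hh]; split_ifs <;> norm_num
  have hsum : ∑ ω ∈ G, ∏ i, p (ω i) ≤ ∏ j, binomialExp (p j) m (h j) := by
    refine le_trans ?_ (multinomial_prod_le hp hp1 m hmono hnn)
    refine le_trans (Finset.sum_le_sum fun ω hω => ?_) (Finset.sum_le_univ_sum_of_nonneg
      fun ω => mul_nonneg (hprod ω) (Finset.prod_nonneg fun j _ => hnn j _))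
    have : ∏ j, h j (occurrences ω j) = 1 := Finset.prod_eq_one fun j _ => if_pos (hG ω hω j).2
    rw [this, mul_one]
  -- For `p j ≤ 2 / n` the constant `1 / 32` gives `4 * ε ^ 2 * (m * p j) ≤ log n / 4`, so the tail
  -- bound is at least `exp (-16 - log n / 2) / 4 = θ`.
  set θ : ℝ := Real.exp (-16) / (4 * √n) with hθ
  have hθ0 : 0 < θ := by positivity
  have hbin : ∀ j, binomialExp (p j) m (h j) ≤ if p j ≤ 2 / n then Real.exp (-θ) else 1 := by
    intro j
    split_ifs with hj
    · have hhalf : p j ≤ 1 / 2 := hj.trans <| by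
        have h4 : (4 : ℝ) ≤ n := by exact_mod_cast hn4
        rw [div_le_div_iff₀ hn0 two_pos]; linarith
      have htail := le_binomialExp_lower_tail (hp0 j) hhalf hε0 hε1 hm0
      have hcompl : h j = fun k : ℕ =>
          1 - 1 * (if (k : ℝ) < (1 - ε) * (m * p j) then (1 : ℝ) else 0) := by
        funext k
        simp only [hh]
        by_cases hk : (1 - ε) * (m * p j) ≤ k
        · rw [if_pos hk, if_neg (not_lt.2 hk)]; ring
        · rw [if_neg hk, if_pos (not_le.1 hk)]; ring
      rw [hcompl, binomialExp_const_sub_mul]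
      have hexp : 4 * ε ^ 2 * (m * p j) ≤ Real.log n / 4 := by
        have hlog : 0 ≤ Real.log n := Real.log_natCast_nonneg n
        calc 4 * ε ^ 2 * (m * p j)
            ≤ 4 * ε ^ 2 * ((1 / 32 * (ε ^ 2)⁻¹ * n * Real.log n) * (2 / n)) := by
              gcongr
              exact hp j
          _ = Real.log n / 4 := by field_simp; ring
      have hθle : θ ≤ Real.exp (-(2 * (4 * ε ^ 2 * (m * p j) + 8))) / 4 := by
        have h1 : θ = Real.exp (-(2 * (Real.log n / 4 + 8))) / 4 := by
          have h2 : -(2 * (Real.log n / 4 + 8)) = -16 - Real.log n / 2 := by ring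
          rw [h2, Real.exp_sub, Real.exp_half, Real.exp_log hn0, hθ, div_div, mul_comm]
        rw [h1]
        gcongr
      have := Real.add_one_le_exp (-θ)
      linarith
    · refine (binomialExp_mono (hp j) (hple j) m (h' := fun _ => 1) fun k => ?_).trans
        (binomialExp_const _ _ _).le
      simp only [hh]; split_ifs <;> norm_num
  refine hsum.trans <| (Finset.prod_le_prod
    (fun j _ => binomialExp_nonneg (hp j) (hple j) m (hnn j)) fun j _ => hbin j).trans ?_
  rw [← Finset.prod_filter, Finset.prod_const, ← Real.exp_nat_mul]
  have hJ := card_le_two_mul_card_filter_le hn hp hp1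
  set x := Real.exp (-16) * √n / 8 with hx
  have hx0 : 0 < x := by positivity
  have hs : √(n : ℝ) * √n = n := Real.mul_self_sqrt hn0.le
  have hxθ : x = n / 2 * θ := by
    have hs0 : √(n : ℝ) ≠ 0 := (Real.sqrt_pos.2 hn0).ne'
    rw [hx, hθ]
    nth_rw 2 [← hs]
    field_simp
    norm_num
  have hle : ((Finset.univ.filter fun j => p j ≤ 2 / n).card : ℝ) * -θ ≤ -x := by
    rw [hxθ]; nlinarith
  refine (Real.exp_le_exp.2 hle).trans ?_
  -- Here `exp (-x) ≤ 2 / x ^ 2 = 128 * exp 32 / n`.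
  have hq := Real.quadratic_le_exp_of_nonneg hx0.le
  have hx2 : x ^ 2 * (64 * Real.exp 32) = n := by
    have : Real.exp (-16) ^ 2 * Real.exp 32 = 1 := by
      rw [← Real.exp_nat_mul, ← Real.exp_add]; norm_num
    calc x ^ 2 * (64 * Real.exp 32)
        = (Real.exp (-16) ^ 2 * Real.exp 32) * (√(n : ℝ) * √(n : ℝ)) := by
          rw [hx]; ring
      _ = (n : ℝ) := by rw [this, hs, one_mul]
  rw [Real.exp_neg, inv_eq_one_div, div_le_div_iff₀ (Real.exp_pos _) hn0, one_mul, ← hx2]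
  have : 0 < Real.exp 32 := Real.exp_pos _
  nlinarith

/-! ### Integrals against the uniform distribution on finitely many points. -/

lemma restrict_uniformOn {E : Type*} [MeasurableSpace E] {s : Set E} (hs : MeasurableSet s) :
    (uniformOn s).restrict s = uniformOn s := by
  rw [uniformOn, ProbabilityTheory.cond, Measure.restrict_smul, Measure.restrict_restrict hs,
    Set.inter_self]

section uniformOn

variable {E : Type*} [MeasurableSpace E] [MeasurableSingletonClass E]

lemma integrable_uniformOn_range {ι : Type*} [Finite ι] (a : ι → E) (f : E → ℝ) :
    Integrable f (uniformOn (Set.range a)) := by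
  have hfin : (Set.range a).Finite := Set.finite_range a
  rw [← restrict_uniformOn hfin.measurableSet]
  exact IntegrableOn.of_finite hfin

lemma uniformOn_range_singleton {n : ℕ} {a : Fin n → E} (ha : Function.Injective a) (j : Fin n) :
    uniformOn (Set.range a) {a j} = (n : ENNReal)⁻¹ := by
  classical
  have h1 : Set.range a = (Finset.univ.image a : Finset E) := by simp
  have h2 : ({a j} : Set E) = ({a j} : Finset E) := by simp
  rw [h1, h2, uniformOn_apply_finset, Finset.inter_singleton_of_mem (by simp),
    Finset.card_image_of_injective _ ha]
  simp

lemma integral_uniformOn_range {n : ℕ} {a : Fin n → E} (ha : Function.Injective a) (f : E → ℝ) :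
    ∫ x, f x ∂uniformOn (Set.range a) = (n : ℝ)⁻¹ * ∑ j, f (a j) := by
  classical
  have h1 : Set.range a = (Finset.univ.image a : Finset E) := by simp
  have h2 : (uniformOn (Set.range a)).restrict (Finset.univ.image a : Finset E)
      = uniformOn (Set.range a) := by
    rw [← h1, restrict_uniformOn (Set.finite_range a).measurableSet]
  rw [← h2, setIntegral_finset _ (integrable_uniformOn_range a f).integrableOn,
    Finset.sum_image fun i _ j _ h => ha h, Finset.mul_sum]
  refine Finset.sum_congr rfl fun j _ => ?_
  rw [measureReal_def, uniformOn_range_singleton ha]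
  simp

end uniformOn

/-! ### Homogeneity and the reduction to balls in bins. -/

lemma reluLoss_mul {c : ℝ} (hc : 0 ≤ c) (r : ℝ) : reluLoss (c * r) = c * reluLoss r := by
  rw [reluLoss, reluLoss, mul_max_of_nonneg _ _ hc, mul_zero, mul_neg]

lemma expectedLoss_smul {d : ℕ} (P : Measure (EuclideanSpace ℝ (Fin d)))
    (x : EuclideanSpace ℝ (Fin d)) {c : ℝ} (hc : 0 ≤ c) :
    expectedLoss P (c • x) = c * expectedLoss P x := by
  simp only [expectedLoss, inner_smul_right, reluLoss_mul hc, integral_const_mul]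

lemma empiricalLoss_smul {d m : ℕ} (P : Measure (EuclideanSpace ℝ (Fin d)))
    (s : EuclideanSpace ℝ (Fin d) → ℝ) (A : Fin m → EuclideanSpace ℝ (Fin d))
    (x : EuclideanSpace ℝ (Fin d)) {c : ℝ} (hc : 0 ≤ c) :
    empiricalLoss P s A (c • x) = c * empiricalLoss P s A x := by
  simp only [empiricalLoss, inner_smul_right, reluLoss_mul hc, Finset.mul_sum]
  exact Finset.sum_congr rfl fun i _ => by ring

/-- By homogeneity, the regularization term does not help. -/
lemma RelErrorGuarantee.abs_sub_le {d m k : ℕ} {P : Measure (EuclideanSpace ℝ (Fin d))}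
    {s : EuclideanSpace ℝ (Fin d) → ℝ} {ε : ℝ} {A : Fin m → EuclideanSpace ℝ (Fin d)}
    (h : RelErrorGuarantee P s k ε A) (x : EuclideanSpace ℝ (Fin d)) :
    |expectedLoss P x - empiricalLoss P s A x| ≤ ε * expectedLoss P x := by
  have hc : ∀ c : ℝ, 0 < c → |expectedLoss P x - empiricalLoss P s A x|
      ≤ ε * (expectedLoss P x + c * (‖x‖ ^ 2 / k)) := by
    intro c hc
    have h1 := h (c • x)
    rw [regularizedLoss, expectedLoss_smul P x hc.le, empiricalLoss_smul P s A x hc.le, ← mul_sub,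
      abs_mul, abs_of_pos hc, norm_smul, Real.norm_of_nonneg hc.le] at h1
    refine le_of_mul_le_mul_left (h1.trans (le_of_eq ?_)) hc
    ring
  have hlim : Filter.Tendsto (fun c : ℝ => ε * (expectedLoss P x + c * (‖x‖ ^ 2 / k)))
      (nhdsWithin 0 (Set.Ioi 0)) (nhds (ε * (expectedLoss P x + 0 * (‖x‖ ^ 2 / k)))) :=
    (Continuous.tendsto (by fun_prop) 0).mono_left nhdsWithin_le_nhds
  rw [zero_mul, add_zero] at hlim
  exact ge_of_tendsto hlim (Filter.mem_of_superset self_mem_nhdsWithin hc)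

lemma sum_comp_eq_sum_occurrences {ι : Type*} [Fintype ι] [DecidableEq ι] {m : ℕ}
    (ω : Fin m → ι) (f : ι → ℝ) : ∑ i, f (ω i) = ∑ j, occurrences ω j * f j := by
  simp only [occurrences, Nat.cast_sum, Finset.sum_mul]
  rw [Finset.sum_comm]
  refine Finset.sum_congr rfl fun i _ => ?_
  simp

/-- If a uniform relative error `ε` forces each individual count to have relative error
`ε' < 1`, then `Ω(ε'⁻² n log n)` samples are required. -/
theorem requiresSamples_of_isolating {d n : ℕ} (hn : 0 < n) {a : Fin n → EuclideanSpace ℝ (Fin d)}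
    (ha : Function.Injective a) {ε ε' M : ℝ} (hε0 : 0 < ε') (hε1 : ε' < 1)
    (hM : M ≤ 1 / 32 * (ε' ^ 2)⁻¹ * n * Real.log n)
    (hiso : ∀ D : Fin n → ℝ, (∀ x, |∑ j, D j * reluLoss (inner ℝ (a j) x)|
      ≤ ε * ∑ j, reluLoss (inner ℝ (a j) x)) → ∀ j, |D j| ≤ ε') :
    RequiresSamples (uniformOn (Set.range a)) ε M (128 * Real.exp 32 / n) := by
  classical
  intro k _ s _ hs0 hS m hm
  set P := uniformOn (Set.range a) with hP
  have hn0 : (0 : ℝ) < n := by exact_mod_cast hn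
  set S := totalScore P s with hSdef
  have hSsum : S = (n : ℝ)⁻¹ * ∑ j, s (a j) := integral_uniformOn_range ha s
  set p : Fin n → ℝ := fun j => s (a j) / (n * S) with hp
  have hp0 : ∀ j, 0 ≤ p j := fun j => div_nonneg (hs0 _) (by positivity)
  have hp1 : ∑ j, p j = 1 := by
    have : ∑ j, s (a j) = n * S := by rw [hSsum]; field_simp
    simp only [hp]
    rw [← Finset.sum_div, this]
    exact div_self (by positivity)
  have hfinite : IsFiniteMeasure (samplingDist P s) :=
    isFiniteMeasure_withDensity_ofReal
      ((integrable_uniformOn_range a fun x => s x / S).hasFiniteIntegral)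
  have hsing : ∀ j, (samplingDist P s).real {a j} = p j := by
    intro j
    rw [measureReal_def, samplingDist, withDensity_apply _ (measurableSet_singleton _),
      lintegral_singleton, uniformOn_range_singleton ha, ENNReal.toReal_mul,
      ENNReal.toReal_ofReal (div_nonneg (hs0 _) hS.le), ENNReal.toReal_inv, ENNReal.toReal_natCast]
    simp only [hp]
    field_simp
  have hinj : Function.Injective fun ω : Fin m → Fin n => a ∘ ω := ha.comp_left
  have hlaw : ∀ ω : Fin m → Fin n, (sampleLaw P s m).real {a ∘ ω} = ∏ i, p (ω i) := by
    intro ω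
    rw [sampleLaw, measureReal_def, Measure.pi_singleton, ENNReal.toReal_prod]
    exact Finset.prod_congr rfl fun i _ => hsing _
  have : IsFiniteMeasure (sampleLaw P s m) := by unfold sampleLaw; infer_instance
  set G : Finset (Fin m → Fin n) :=
    Finset.univ.filter fun ω => RelErrorGuarantee P s k ε (a ∘ ω) with hG
  have hgood : ∀ ω ∈ G, ∀ j, 0 < m * p j ∧ (1 - ε') * (m * p j) ≤ occurrences ω j := by
    intro ω hω
    have hguar := (Finset.mem_filter.1 hω).2
    have hD := hiso (fun j => 1 - occurrences ω j / (m * p j)) fun x => by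
      have h1 := hguar.abs_sub_le x
      have hf0 : expectedLoss P x = (n : ℝ)⁻¹ * ∑ j, reluLoss (inner ℝ (a j) x) :=
        integral_uniformOn_range ha _
      have hemp : empiricalLoss P s (a ∘ ω) x
          = (n : ℝ)⁻¹ * ∑ j, occurrences ω j / (m * p j) * reluLoss (inner ℝ (a j) x) := by
        rw [empiricalLoss]
        simp only [Function.comp_apply]
        rw [sum_comp_eq_sum_occurrences ω
          fun j => sampleWeight P s (a j) * reluLoss (inner ℝ (a j) x), Finset.mul_sum,
          Finset.mul_sum]
        refine Finset.sum_congr rfl fun j _ => ?_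
        simp only [sampleWeight, hp, ← hSdef]
        -- Only `n` is cancelled, so the identity also covers `m = 0` and `s (a j) = 0`, where
        -- division by zero gives zero.
        have : (n : ℝ)⁻¹ * (occurrences ω j / (m * (s (a j) / (n * S)))
            * reluLoss (inner ℝ (a j) x))
            = (n * (n : ℝ)⁻¹) * (1 / m * (occurrences ω j * (S / s (a j)
              * reluLoss (inner ℝ (a j) x)))) := by
          simp only [div_eq_mul_inv, mul_inv, inv_inv]
          ring
        rw [this, mul_inv_cancel₀ hn0.ne', one_mul]
      rw [hemp, hf0, ← mul_sub, abs_mul, abs_of_pos (inv_pos.2 hn0), mul_left_comm,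
        ← Finset.sum_sub_distrib] at h1
      have h2 := le_of_mul_le_mul_left h1 (inv_pos.2 hn0)
      simpa only [sub_mul, one_mul] using h2
    intro j
    have h1 := (abs_le.1 (hD j)).2
    have h2 : 1 - ε' ≤ occurrences ω j / (m * p j) := by linarith
    have h3 : 0 < m * p j := by
      -- If `m * p j = 0`, the quotient is `0` by convention, contradicting `1 - ε' > 0`.
      refine lt_of_le_of_ne (mul_nonneg (Nat.cast_nonneg m) (hp0 j)) fun h => ?_
      rw [← h, div_zero] at h2
      linarith
    exact ⟨h3, (le_div_iff₀ h3).1 h2⟩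
  have hcore := multinomial_all_large_le hn hp0 hp1 hε0 hε1 (hm.trans hM) G hgood
  have hbad : ∑ ω ∈ Gᶜ, ∏ i, p (ω i)
      ≤ (sampleLaw P s m).real {A | ¬ RelErrorGuarantee P s k ε A} := by
    calc ∑ ω ∈ Gᶜ, ∏ i, p (ω i) = ∑ A ∈ Gᶜ.image (fun ω => a ∘ ω), (sampleLaw P s m).real {A} := by
          rw [Finset.sum_image fun _ _ _ _ h => hinj h]
          exact Finset.sum_congr rfl fun ω _ => (hlaw ω).symm
      _ = (sampleLaw P s m).real (Gᶜ.image (fun ω => a ∘ ω) : Finset _) :=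
          sum_measureReal_singleton _
      _ ≤ _ := by
          -- Monotonicity needs no measurability of the failure event, only the finitely many
          -- failing atoms inside it.
          refine measureReal_mono ?_
          intro A hA
          obtain ⟨ω, hω, rfl⟩ := Finset.mem_image.1 (Finset.mem_coe.1 hA)
          simpa [hG] using hω
  have htot : ∑ ω ∈ G, ∏ i, p (ω i) + ∑ ω ∈ Gᶜ, ∏ i, p (ω i) = 1 := by
    rw [Finset.sum_add_sum_compl, ← Fintype.sum_pow, hp1, one_pow]
  linarith

/-! ### Isolating points of the moment curve. -/

lemma reluLoss_nonneg (r : ℝ) : 0 ≤ reluLoss r := le_max_left _ _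

lemma reluLoss_of_nonneg {r : ℝ} (h : 0 ≤ r) : reluLoss r = 0 := max_eq_left (neg_nonpos.2 h)

lemma reluLoss_of_nonpos {r : ℝ} (h : r ≤ 0) : reluLoss r = -r := max_eq_right (neg_nonneg.2 h)

lemma momentCurve_injective {d : ℕ} (hd : 2 ≤ d) : Function.Injective (momentCurve d) := by
  intro t u h
  simpa [momentCurve] using congrArg (fun v : EuclideanSpace ℝ (Fin d) => v ⟨1, hd⟩) h

/-- Evaluation of a quadratic polynomial on the moment curve is a linear functional. -/
lemma exists_inner_momentCurve_eq {d : ℕ} (hd : 3 ≤ d) (b₀ b₁ b₂ : ℝ) :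
    ∃ x : EuclideanSpace ℝ (Fin d), ∀ t,
      inner ℝ (momentCurve d t) x = b₀ + b₁ * t + b₂ * t ^ 2 := by
  obtain ⟨e, rfl⟩ := Nat.exists_eq_add_of_le' hd
  refine ⟨WithLp.toLp 2 fun i => if (i : ℕ) = 0 then b₀ else if (i : ℕ) = 1 then b₁ else
    if (i : ℕ) = 2 then b₂ else 0, fun t => ?_⟩
  simp only [momentCurve, PiLp.inner_apply, Fin.sum_univ_succ, Fin.val_succ, Fin.val_zero]
  have hne (i : Fin e) : (i : ℕ) + 1 + 1 + 1 ≠ 2 := by omega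
  norm_num [hne]
  ring

lemma momentCurve_isolating {d n : ℕ} (hd : 3 ≤ d) {t : Fin n → ℝ} (ht : Function.Injective t)
    {ε : ℝ} {D : Fin n → ℝ}
    (hD : ∀ x, |∑ j, D j * reluLoss (inner ℝ (momentCurve d (t j)) x)|
      ≤ ε * ∑ j, reluLoss (inner ℝ (momentCurve d (t j)) x)) (j : Fin n) : |D j| ≤ ε := by
  obtain ⟨δ, hδ, hδ0⟩ : ∃ δ : ℝ, (∀ i, i ≠ j → δ < (t i - t j) ^ 2) ∧ 0 < δ := by
    have h1 : ∀ᶠ δ : ℝ in nhdsWithin 0 (Set.Ioi 0), ∀ i, i ≠ j → δ < (t i - t j) ^ 2 := by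
      refine Filter.eventually_all.2 fun i => ?_
      by_cases hij : i = j
      · exact Filter.Eventually.of_forall fun _ h => absurd hij h
      · have : (0 : ℝ) < (t i - t j) ^ 2 := by
          have := sub_ne_zero.2 (ht.ne hij)
          positivity
        exact ((eventually_lt_nhds this).filter_mono nhdsWithin_le_nhds).mono fun _ h _ => h
    exact (h1.and self_mem_nhdsWithin).exists
  -- The quadratic `(t - t j) ^ 2 - δ` is negative at `t j` and positive at the other parameters.
  obtain ⟨x, hx⟩ := exists_inner_momentCurve_eq hd (t j ^ 2 - δ) (-2 * t j) 1
  have hval : ∀ i, reluLoss (inner ℝ (momentCurve d (t i)) x) = if i = j then δ else 0 := by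
    intro i
    rw [hx]
    split_ifs with hij
    · subst hij
      rw [reluLoss_of_nonpos] <;> nlinarith
    · refine reluLoss_of_nonneg ?_
      have := hδ i hij
      nlinarith
  have h := hD x
  simp only [hval, mul_ite, mul_zero, Finset.sum_ite_eq', Finset.mem_univ, if_true, abs_mul,
    abs_of_pos hδ0] at h
  exact le_of_mul_le_mul_right h hδ0

/-! ### Isolating geometrically growing points in dimension two and above. -/

/-- The points `ρ ^ j • (1, j, 0, …, 0)`. -/
noncomputable def geometricPoint (d : ℕ) (ρ : ℝ) (j : ℕ) : EuclideanSpace ℝ (Fin d) :=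
  WithLp.toLp 2 fun i => if (i : ℕ) = 0 then ρ ^ j else if (i : ℕ) = 1 then ρ ^ j * j else 0

lemma geometricPoint_injective {d : ℕ} (hd : 2 ≤ d) {ρ : ℝ} (hρ : 1 < ρ) :
    Function.Injective (geometricPoint d ρ) := by
  intro i j h
  have h0 : ρ ^ i = ρ ^ j := by
    simpa [geometricPoint] using
      congrArg (fun v : EuclideanSpace ℝ (Fin d) => v ⟨0, by omega⟩) h
  exact pow_right_injective₀ (by linarith) hρ.ne' h0

lemma exists_inner_geometricPoint_eq {d : ℕ} (hd : 2 ≤ d) (ρ b : ℝ) :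
    ∃ x : EuclideanSpace ℝ (Fin d), ∀ j, inner ℝ (geometricPoint d ρ j) x = ρ ^ j * (j - b) := by
  obtain ⟨e, rfl⟩ := Nat.exists_eq_add_of_le' hd
  refine ⟨WithLp.toLp 2 fun i => if (i : ℕ) = 0 then -b else if (i : ℕ) = 1 then 1 else 0,
    fun j => ?_⟩
  simp only [geometricPoint, PiLp.inner_apply, Fin.sum_univ_succ]
  simp
  ring

/-- The sums satisfy `S (l + 1) = 2 * (S l + ρ ^ l)`, so the hypothesis on `ρ` is exactly what the
induction needs. -/
lemma sum_range_pow_mul_two_pow_le {κ ρ : ℝ} (hκ : 0 ≤ κ) (hρ0 : 0 ≤ ρ)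
    (hρ : 2 * (κ + 1) ≤ κ * ρ) (l : ℕ) :
    ∑ i ∈ Finset.range l, ρ ^ i * 2 ^ (l - i) ≤ κ * ρ ^ l := by
  induction l with
  | zero => simpa using hκ
  | succ l ih =>
    have h1 : ∑ i ∈ Finset.range l, ρ ^ i * (2 : ℝ) ^ (l + 1 - i)
        = 2 * ∑ i ∈ Finset.range l, ρ ^ i * 2 ^ (l - i) := by
      rw [Finset.mul_sum]
      refine Finset.sum_congr rfl fun i hi => ?_
      rw [Nat.succ_sub (Finset.mem_range.1 hi).le, pow_succ]
      ring
    rw [Finset.sum_range_succ, h1, Nat.add_sub_cancel_left, pow_one, pow_succ]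
    have : 0 ≤ ρ ^ l := pow_nonneg hρ0 l
    nlinarith

/-- Strong induction on `l`: a query with zero loss beyond `l` gives loss `ρ ^ l` at `l` and at most
`κ * ρ ^ l` in total before it. The earlier errors are already at most `ε'`, so `|D l| ≤ ε + (ε +
ε') * κ ≤ ε'`. -/
lemma geometricPoint_isolating {d n : ℕ} (hd : 2 ≤ d) {κ ρ ε ε' : ℝ} (hκ : 0 ≤ κ) (hρ0 : 0 < ρ)
    (hρ : 2 * (κ + 1) ≤ κ * ρ) (hε : 0 ≤ ε) (hε' : 0 ≤ ε') (hκε : (ε + ε') * κ ≤ ε' - ε)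
    {D : Fin n → ℝ}
    (hD : ∀ x, |∑ j : Fin n, D j * reluLoss (inner ℝ (geometricPoint d ρ j) x)|
      ≤ ε * ∑ j : Fin n, reluLoss (inner ℝ (geometricPoint d ρ j) x)) (l : Fin n) :
    |D l| ≤ ε' := by
  obtain ⟨l, hl⟩ := l
  induction l using Nat.strong_induction_on with
  | _ l ih =>
    -- The sign changes at `l + 1`, so that the loss at `l` itself does not vanish.
    obtain ⟨x, hx⟩ := exists_inner_geometricPoint_eq hd ρ (l + 1 : ℝ)
    set w : ℕ → ℝ := fun j => reluLoss (inner ℝ (geometricPoint d ρ j) x) with hw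
    have hw0 : ∀ j, 0 ≤ w j := fun j => reluLoss_nonneg _
    have hwl : w l = ρ ^ l := by
      have : ρ ^ l * ((l : ℝ) - (l + 1)) = -ρ ^ l := by ring
      simp only [hw, hx]
      rw [this, reluLoss_of_nonpos (neg_nonpos.2 (pow_nonneg hρ0.le l)), neg_neg]
    have hwgt : ∀ j, l < j → w j = 0 := by
      intro j hj
      have h1 : (l : ℝ) + 1 ≤ j := by exact_mod_cast hj
      simp only [hw, hx]
      exact reluLoss_of_nonneg (mul_nonneg (pow_nonneg hρ0.le j) (sub_nonneg.2 h1))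
    have hwlt : ∀ j, j < l → w j ≤ ρ ^ j * 2 ^ (l - j) := by
      intro j hj
      have h1 : (j : ℝ) ≤ l := by exact_mod_cast hj.le
      have h2 : (l : ℝ) + 1 - j ≤ 2 ^ (l - j) := by
        have h3 : l - j + 1 ≤ 2 ^ (l - j) := Nat.lt_two_pow_self
        have h4 : ((l - j : ℕ) : ℝ) + 1 ≤ 2 ^ (l - j) := by exact_mod_cast h3
        rw [Nat.cast_sub hj.le] at h4
        linarith
      have hpos : 0 ≤ ρ ^ j := pow_nonneg hρ0.le j
      simp only [hw, hx]
      rw [reluLoss_of_nonpos (mul_nonpos_of_nonneg_of_nonpos hpos (by linarith)), ← mul_neg,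
        neg_sub]
      exact mul_le_mul_of_nonneg_left h2 hpos
    set L : Fin n := ⟨l, hl⟩ with hL
    set T := ∑ j ∈ Finset.univ.erase L, w j with hT
    have hTle : T ≤ κ * ρ ^ l := by
      refine le_trans ?_ (sum_range_pow_mul_two_pow_le hκ hρ0.le hρ l)
      calc T ≤ ∑ j ∈ Finset.univ.erase L,
              if (j : ℕ) < l then ρ ^ (j : ℕ) * 2 ^ (l - (j : ℕ)) else 0 := by
            refine Finset.sum_le_sum fun j hj => ?_
            have hne : (j : ℕ) ≠ l := fun h => (Finset.mem_erase.1 hj).1 (Fin.ext h)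
            split_ifs with hjl
            · exact hwlt j hjl
            · exact (hwgt j (by omega)).le
        _ ≤ ∑ j : Fin n, if (j : ℕ) < l then ρ ^ (j : ℕ) * 2 ^ (l - (j : ℕ)) else 0 := by
            refine Finset.sum_le_univ_sum_of_nonneg fun j => ?_
            split_ifs <;> positivity
        _ = ∑ j ∈ (Finset.range n).filter (· < l), ρ ^ j * 2 ^ (l - j) := by
            rw [Fin.sum_univ_eq_sum_range
              (fun j => if j < l then ρ ^ j * (2 : ℝ) ^ (l - j) else 0) n, Finset.sum_filter]
        _ ≤ ∑ j ∈ Finset.range l, ρ ^ j * 2 ^ (l - j) := by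
            refine Finset.sum_le_sum_of_subset_of_nonneg (fun j hj => ?_) fun j _ _ => by positivity
            exact Finset.mem_range.2 (Finset.mem_filter.1 hj).2
    have hrest : |∑ j ∈ Finset.univ.erase L, D j * w j| ≤ ε' * T := by
      rw [hT, Finset.mul_sum]
      refine (Finset.abs_sum_le_sum_abs _ _).trans (Finset.sum_le_sum fun j hj => ?_)
      have hne : (j : ℕ) ≠ l := fun h => (Finset.mem_erase.1 hj).1 (Fin.ext h)
      rw [abs_mul, abs_of_nonneg (hw0 j)]
      rcases lt_or_ge (j : ℕ) l with hjl | hjl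
      · exact mul_le_mul_of_nonneg_right (ih j hjl j.2) (hw0 j)
      · rw [hwgt j (by omega), mul_zero, mul_zero]
    have h := hD x
    have e1 : ∑ j : Fin n, D j * w j = D L * w l + ∑ j ∈ Finset.univ.erase L, D j * w j :=
      (Finset.add_sum_erase _ _ (Finset.mem_univ L)).symm
    have e2 : ∑ j : Fin n, w j = w l + T :=
      (Finset.add_sum_erase _ (fun j : Fin n => w j) (Finset.mem_univ L)).symm
    change |∑ j : Fin n, D j * w j| ≤ ε * ∑ j : Fin n, w j at h
    rw [e1, e2, hwl] at h
    have hpos : 0 < ρ ^ l := pow_pos hρ0 l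
    have habs : |D L * ρ ^ l| ≤ ε * (ρ ^ l + T) + ε' * T := by
      have := abs_sub_abs_le_abs_sub (D L * ρ ^ l) (-∑ j ∈ Finset.univ.erase L, D j * w j)
      rw [sub_neg_eq_add, abs_neg] at this
      linarith
    rw [abs_mul, abs_of_pos hpos] at habs
    refine le_of_mul_le_mul_right (habs.trans ?_) hpos
    have h5 : (ε + ε') * T ≤ (ε + ε') * (κ * ρ ^ l) :=
      mul_le_mul_of_nonneg_left hTle (add_nonneg hε hε')
    have h6 : (ε + ε') * κ * ρ ^ l ≤ (ε' - ε) * ρ ^ l := mul_le_mul_of_nonneg_right hκε hpos.le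
    linarith

/-! ### Choice of constants. -/

lemma mul_inv_sq_mul_log_le {c c' ε ε' : ℝ} {n : ℕ} (h : c * (ε ^ 2)⁻¹ ≤ c' * (ε' ^ 2)⁻¹) :
    c * (ε ^ 2)⁻¹ * n * Real.log n ≤ c' * (ε' ^ 2)⁻¹ * n * Real.log n := by
  have := Real.log_natCast_nonneg n
  gcongr

theorem mainTheorem7 :
    ∃ c C : ℝ, 0 < c ∧ 0 < C ∧
      (∀ d n : ℕ, 2 ≤ d → d ≤ n → ∀ ε : ℝ, 0 < ε → ε < 1 →
        ∃ a : Fin n → EuclideanSpace ℝ (Fin d), Function.Injective a ∧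
          RequiresSamples (uniformOn (Set.range a)) ε
            (c * (ε ^ 2)⁻¹ * n * Real.log n) (C / n)) ∧
      (∀ d n : ℕ, 3 ≤ d → d ≤ n → ∀ t : Fin n → ℝ, Function.Injective t →
        ∀ ε : ℝ, 0 < ε → ε < 1 →
          RequiresSamples (uniformOn (Set.range (fun j => momentCurve d (t j)))) ε
            (c * (ε ^ 2)⁻¹ * n * Real.log n) (C / n)) := by
  -- `1 / 72 = (1 / 32) * (2 / 3) ^ 2` pays for `ε' ≤ 3 / 2 * ε`.
  refine ⟨1 / 72, 128 * Real.exp 32, by norm_num, by positivity, ?_, ?_⟩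
  · intro d n hd hn ε hε0 hε1
    -- `ε'` is the midpoint-type choice `ε + ε * (1 - ε) / 2`, which stays below `1`; as `ε + ε' ≤ 5
    -- / 2 * ε`, the factor `κ = (1 - ε) / 5` fits into the slack `ε' - ε`.
    set ε' := ε * (3 - ε) / 2 with hε'
    set κ := (1 - ε) / 5 with hκ
    have hκ0 : 0 < κ := div_pos (sub_pos.2 hε1) (by norm_num)
    have hε'0 : 0 < ε' := div_pos (mul_pos hε0 (by linarith)) two_pos
    have hε'1 : ε' < 1 := by rw [hε']; nlinarith
    have hκε : (ε + ε') * κ ≤ ε' - ε := by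
      have : ε' - ε - (ε + ε') * κ = ε ^ 2 * (1 - ε) / 10 := by rw [hε', hκ]; ring
      have h2 : 0 ≤ ε ^ 2 * (1 - ε) / 10 :=
        div_nonneg (mul_nonneg (sq_nonneg _) (sub_nonneg.2 hε1.le)) (by norm_num)
      linarith
    set ρ := 2 * (κ + 1) / κ with hρ
    have hρκ : κ * ρ = 2 * (κ + 1) := mul_div_cancel₀ _ hκ0.ne'
    have hρ1 : 1 < ρ := by rw [hρ, one_lt_div hκ0]; linarith
    have hinj : Function.Injective fun j : Fin n => geometricPoint d ρ j :=
      (geometricPoint_injective hd hρ1).comp Fin.val_injective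
    refine ⟨_, hinj, requiresSamples_of_isolating (by omega) hinj hε'0 hε'1
      (mul_inv_sq_mul_log_le ?_) fun D hD =>
        geometricPoint_isolating hd hκ0.le (zero_lt_one.trans hρ1) hρκ.ge hε0.le hε'0.le hκε hD⟩
    rw [← div_eq_mul_inv, ← div_eq_mul_inv, div_le_div_iff₀ (by positivity) (by positivity)]
    have h1 : ε' ≤ 3 / 2 * ε := by rw [hε']; nlinarith
    have h2 : ε' ^ 2 ≤ (3 / 2 * ε) ^ 2 := by gcongr
    linarith
  · intro d n hd hn t ht ε hε0 hε1
    refine requiresSamples_of_isolating (by omega)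
      ((momentCurve_injective (by omega)).comp ht) hε0 hε1 (mul_inv_sq_mul_log_le ?_)
      fun D hD => momentCurve_isolating hd ht hD
    gcongr
    norm_num
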